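/- For a nonempty compact set $E\subset\mathbb{C}$ and a polynomial $p\in\mathbb{Z}[z]$ put $\|p\|_E=\sup_{z\in E}|p(z)|$. For $n\ge 0$ let $m(n,E)$ be the minimum of $\|p\|_E$ over the nonzero polynomials $p$ with integer coefficients and degree exactly $n$, and let $M(E)=\lim_{n\to\infty}m(n,E)^{1/n}$ whenever this limit exists. Let $D$ be the closed disc of center $\frac12$ and radius $\frac12$, and $D'$ the closed disc of center $\frac14$ and radius $\frac14$. Then the minima $m(n,D)$ and $m(n,D')$ are attained for every $n$, the limits $M(D)$ and $M(D')$ exist, and $$M(D')=M(D)^2,\qquad 0.64<M(D)<0.67,\qquad 0.42<M(D')<0.44 .$$ In particular, for all sufficiently large $n$, $$0.42^n<m(n,D')<0.44^n\qquad\text{and}\qquad 0.64^n<m(n,D)<0.67^n .$$ Moreover, for every $n\ge 0$, every nonzero $p\in\mathbb{Z}[z]$ of degree at most $n$ satisfies $-\log\|p\|_{D'}\le n\log(1+\sqrt2)$, where $\log(1+\sqrt2)<0.89$; and the polynomial $$s(z)=z^{34}(2z-1)^6(5z^2-4z+1)^3(29z^4-44z^3+27z^2-8z+1)$$ of degree $50$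 satisfies $-\frac1{50}\log\|s\|_{D'}>0.82$. -/

import Mathlib

open Filter Topology Polynomial

/-- The sup norm over `E ⊆ ℂ` of a polynomial with integer coefficients. (For the nonempty compact
sets `E` considered here the set of values is nonempty and bounded, so this is a true supremum.) -/
noncomputable def supNormOn (E : Set ℂ) (p : ℤ[X]) : ℝ :=
  sSup ((fun z : ℂ => ‖aeval z p‖) '' E)

/-- The set of all sup norms over `E` of nonzero integer polynomials of degree exactly `n`. -/
def supNormValues (n : ℕ) (E : Set ℂ) : Set ℝ :=
  {r : ℝ | ∃ p : ℤ[X], p ≠ 0 ∧ p.natDegree = n ∧ supNormOn E p = r}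

/-- `m(n, E)`: the minimal sup norm over `E` of a nonzero integer polynomial of degree `n`. -/
noncomputable def minSupNorm (n : ℕ) (E : Set ℂ) : ℝ :=
  sInf (supNormValues n E)

/-- `M` is the limit of `m(n, E)^{1/n}` as `n → ∞`. -/
def IsMinSupNormLimit (E : Set ℂ) (M : ℝ) : Prop :=
  Tendsto (fun n : ℕ => minSupNorm n E ^ (1 / (n : ℝ))) atTop (𝓝 M)

/-- The closed disc of center `1/2` and radius `1/2`. -/
def halfDisc : Set ℂ := Metric.closedBall (1 / 2) (1 / 2)

/-- The closed disc of center `1/4` and radius `1/4`. -/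
def quarterDisc : Set ℂ := Metric.closedBall (1 / 4) (1 / 4)

/-! Lower bound. The map `z = 1 / (2 + s)` sends the imaginary axis into the quarter disc, so an
integer `p` of degree at most `n` and norm `B` gives the integer polynomial `T(s) = (2 + s)^n p(1 /
(2 + s))` with `|T(iy)| ≤ B |2 + iy|^n`. Take the resultant of `T` with `ζ M(-s²) - (1 + ζ²)
P(-s²)`. For `|ζ| = 1` this is `ζ` times a level polynomial, whose eight roots are purely imaginary,
so the resultant is at most `B^8 (1021 - 40 Re ζ)^n`. At `ζ = 0` only the roots `0, 0, i, -i`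
remain, and integrality makes the resultant at least `1` once the factors `X` and `X² + 1` of `T`
are removed. The maximum principle yields `1 ≤ B^8 1021^n` (`one_le_of_norm_aeval_le`), and
`1021^(-1/8) > 0.42`.

Upper bound. On the boundary circle the degree-50 polynomial has modulus depending only on `t =
4|z|²`; a subdivision of `[0, 1]` bounds its norm by `0.438^50`.

The discs are linked by `z ↦ z (1 - z)`, under which `halfDisc` is the preimage of `quarterDisc`.
Composition gives one inequality between minima, the symmetrization `p(z) p(1 - z)` the other.
Limits exist by subadditivity of `log m(n, E)`. -/

/-! ### Lower bound on the imaginary axis by a family of resultants. -/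

/-- The level polynomials `M - x P`, `|x| ≤ 2`, with `M = u⁴ - 7.6 u³ + 15.2 u² - 8.6 u + 1` and
`P = u (u - 1)`, have only nonnegative real roots. -/
theorem exists_real_roots_sq (x : ℝ) (h1 : -2 ≤ x) (h2 : x ≤ 2) :
    ∃ y : Fin 4 → ℝ, ∀ s : ℂ,
      s ^ 8 + 38 / 5 * s ^ 6 + 76 / 5 * s ^ 4 + 43 / 5 * s ^ 2 + 1 - x * (s ^ 4 + s ^ 2) =
        ∏ j, (s ^ 2 + (y j : ℂ) ^ 2) := by
  set G : ℝ[X] := X ^ 4 - C (38 / 5) * X ^ 3 + C (76 / 5 - x) * X ^ 2 + C (x - 43 / 5) * X + C 1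
    with hG
  have hGe (u : ℝ) : G.eval u =
      u ^ 4 - 38 / 5 * u ^ 3 + (76 / 5 - x) * u ^ 2 + (x - 43 / 5) * u + 1 := by
    simp [hG]
  have hcont (a b : ℝ) : ContinuousOn (fun u => G.eval u) (Set.Icc a b) :=
    G.continuous.continuousOn
  -- At `0` and `1` the `x`-term vanishes and `G = 1`; at the other three points the sign is the
  -- same for all `|x| ≤ 2`. The four sign changes account for all roots.
  have e0 : 0 < G.eval 0 := by rw [hGe]; norm_num
  have e1 : G.eval (9 / 25) < 0 := by rw [hGe]; norm_num; linarith
  have e2 : 0 < G.eval 1 := by rw [hGe]; norm_num; linarith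
  have e3 : G.eval (7 / 2) < 0 := by rw [hGe]; norm_num; linarith
  have e4 : 0 < G.eval 10 := by rw [hGe]; norm_num; linarith
  obtain ⟨a, ⟨ha, ha'⟩, ra⟩ := intermediate_value_Ioo' (by norm_num) (hcont 0 (9 / 25)) ⟨e1, e0⟩
  obtain ⟨b, ⟨hb, hb'⟩, rb⟩ := intermediate_value_Ioo (by norm_num) (hcont (9 / 25) 1) ⟨e1, e2⟩
  obtain ⟨c, ⟨hc, hc'⟩, rc⟩ := intermediate_value_Ioo' (by norm_num) (hcont 1 (7 / 2)) ⟨e3, e2⟩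
  obtain ⟨d, ⟨hd, hd'⟩, rd⟩ := intermediate_value_Ioo (by norm_num) (hcont (7 / 2) 10) ⟨e3, e4⟩
  have hGm : G.Monic := by rw [hG]; monicity!
  have hGd : G.natDegree = 4 := by rw [hG]; compute_degree!
  have hprod : G = ∏ j, (X - C ((![a, b, c, d] : Fin 4 → ℝ) j)) := by
    refine eq_of_monic_of_dvd_of_natDegree_le (monic_prod_of_monic _ _ fun j _ => monic_X_sub_C _)
      hGm ?_ ?_
    · refine Finset.prod_dvd_of_coprime ?_ ?_
      · intro i _ j _ hij
        refine (pairwise_coprime_X_sub_C ?_) hij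
        intro i j h
        fin_cases i <;> fin_cases j <;> simp at h ⊢ <;> linarith
      · intro j _
        rw [dvd_iff_isRoot]
        fin_cases j <;> assumption
    · rw [hGd, natDegree_prod_of_monic _ _ fun j _ => monic_X_sub_C _]
      simp
  refine ⟨fun j => √((![a, b, c, d] : Fin 4 → ℝ) j), fun s => ?_⟩
  have hs : ∀ j, ((√((![a, b, c, d] : Fin 4 → ℝ) j) : ℝ) : ℂ) ^ 2 =
      ((![a, b, c, d] : Fin 4 → ℝ) j : ℂ) := by
    intro j
    rw [← Complex.ofReal_pow, Real.sq_sqrt]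
    fin_cases j <;> simp <;> linarith
  -- Substituting `u = -s²` turns each `u - y²` into `-(s² + y²)`; the four signs cancel.
  have := congrArg (fun p : ℝ[X] => (p.map (algebraMap ℝ ℂ)).eval (-s ^ 2)) hprod
  simp only [hG, Polynomial.map_prod, eval_prod] at this
  simp only [hs]
  simp [Fin.prod_univ_four] at this ⊢
  linear_combination this

/-- The factor attached to a root `α` by the family `ζ M(-s²) - (1 + ζ²) P(-s²)` with
`M = u⁴ - 7.6 u³ + 15.2 u² - 8.6 u + 1` and `P = u (u - 1)`. -/
noncomputable def levelFactor (ζ α : ℂ) : ℂ :=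
  ζ * (α ^ 8 + 38 / 5 * α ^ 6 + 76 / 5 * α ^ 4 + 43 / 5 * α ^ 2 + 1) -
    (1 + ζ ^ 2) * (α ^ 4 + α ^ 2)

/-- The normalized resultant of `T` with the family of `levelFactor`. -/
noncomputable def levelResultant (T : ℂ[X]) (ζ : ℂ) : ℂ :=
  T.leadingCoeff ^ 8 * (T.roots.map (levelFactor ζ)).prod

theorem levelResultant_mul {S T : ℂ[X]} (hS : S ≠ 0) (hT : T ≠ 0) (ζ : ℂ) :
    levelResultant (S * T) ζ = levelResultant S ζ * levelResultant T ζ := by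
  simp only [levelResultant, leadingCoeff_mul, roots_mul (mul_ne_zero hS hT), Multiset.map_add,
    Multiset.prod_add]
  ring

theorem levelResultant_X (ζ : ℂ) : levelResultant X ζ = ζ := by
  simp [levelResultant, levelFactor]

theorem levelResultant_X_sq_add_one (ζ : ℂ) : levelResultant (X ^ 2 + 1) ζ = ζ ^ 2 := by
  have h : (X ^ 2 + 1 : ℂ[X]) = (X - C Complex.I) * (X - C (-Complex.I)) := by
    have : (C Complex.I * C Complex.I : ℂ[X]) = -1 := by rw [← C_mul]; simp
    simp only [C_neg]
    linear_combination this
  have h2 := Complex.I_sq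
  have h4 : Complex.I ^ 4 = 1 := Complex.I_pow_four
  have h6 : Complex.I ^ 6 = -1 := by rw [show 6 = 4 + 2 from rfl, pow_add, h4, h2]; ring
  have h8 : Complex.I ^ 8 = 1 := by rw [show 8 = 4 + 4 from rfl, pow_add, h4]; ring
  rw [h, levelResultant_mul (X_sub_C_ne_zero _) (X_sub_C_ne_zero _)]
  simp only [levelResultant, leadingCoeff_X_sub_C, roots_X_sub_C, Multiset.map_singleton,
    Multiset.prod_singleton, levelFactor, (by decide : Even 8).neg_pow, (by decide : Even 6).neg_pow,
    (by decide : Even 4).neg_pow, (by decide : Even 2).neg_pow, h2, h4, h6, h8]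
  ring

theorem norm_multiset_prod_map (m : Multiset ℂ) (f : ℂ → ℂ) :
    ‖(m.map f).prod‖ = (m.map fun a => ‖f a‖).prod := by
  induction m using Multiset.induction with
  | empty => simp
  | cons a m ih => simp [ih]

theorem norm_eval_eq_prod_roots (T : ℂ[X]) (z : ℂ) :
    ‖T.eval z‖ = ‖T.leadingCoeff‖ * (T.roots.map fun α => ‖z - α‖).prod := by
  rw [(IsAlgClosed.splits T).eval_eq_prod_roots, norm_mul]
  congr 1
  exact norm_multiset_prod_map _ _

theorem norm_levelResultant_eq (T : ℂ[X]) (ζ : ℂ) :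
    ‖levelResultant T ζ‖ =
      ‖T.leadingCoeff‖ ^ 8 * (T.roots.map fun α => ‖levelFactor ζ α‖).prod := by
  rw [levelResultant, norm_mul, norm_pow]
  congr 1
  exact norm_multiset_prod_map _ _

/-- At `ζ = 0` the factor degenerates to `-α² (α² + 1)`: four of the eight roots escape to infinity,
leaving a fourth power of the leading coefficient. -/
theorem norm_levelResultant_zero (T : ℂ[X]) :
    ‖levelResultant T 0‖ = ‖T.leadingCoeff‖ ^ 4 *
      (‖T.eval 0‖ ^ 2 * (‖T.eval Complex.I‖ * ‖T.eval (-Complex.I)‖)) := by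
  have h : (fun α => ‖levelFactor 0 α‖) =
      fun α : ℂ => ‖0 - α‖ * ‖0 - α‖ * (‖Complex.I - α‖ * ‖-Complex.I - α‖) := by
    funext α
    rw [← norm_mul, ← norm_mul, ← norm_mul]
    rw [← norm_neg]
    congr 1
    simp only [levelFactor]
    linear_combination α ^ 2 * Complex.I_sq
  rw [norm_levelResultant_eq, h]
  simp only [Multiset.prod_map_mul, norm_eval_eq_prod_roots]
  ring

/-- On the unit circle `1 + ζ² = 2 (Re ζ) ζ`, so `ζ` factors out and a level polynomial with `x = 2
Re ζ` is left. -/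
theorem norm_levelFactor_of_norm_eq_one {ζ : ℂ} (hζ : ‖ζ‖ = 1) (α : ℂ) :
    ‖levelFactor ζ α‖ = ‖α ^ 8 + 38 / 5 * α ^ 6 + 76 / 5 * α ^ 4 + 43 / 5 * α ^ 2 + 1 -
      ((2 * ζ.re : ℝ) : ℂ) * (α ^ 4 + α ^ 2)‖ := by
  have h : ζ * (starRingEnd ℂ) ζ = 1 := by
    rw [Complex.mul_conj, Complex.normSq_eq_norm_sq, hζ]; simp
  have h2 : ((2 * ζ.re : ℝ) : ℂ) = ζ + (starRingEnd ℂ) ζ := by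
    rw [Complex.add_conj]
  rw [← one_mul ‖α ^ 8 + _ + _ + _ + _ - _‖, ← hζ, ← norm_mul, h2, levelFactor]
  congr 1
  linear_combination (α ^ 4 + α ^ 2) * h

theorem Multiset.prod_map_finset_prod {ι α : Type*} (m : Multiset α) (s : Finset ι)
    (f : ι → α → ℝ) : (m.map fun a => ∏ i ∈ s, f i a).prod = ∏ i ∈ s, (m.map (f i)).prod := by
  induction m using Multiset.induction with
  | empty => simp
  | cons a m ih => simp [ih, Finset.prod_mul_distrib]

/-- Reciprocity of the resultant: the product over roots of `T` becomes the product of `|T|` over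
the roots `±i y j` of the level polynomial, where `hT` applies. -/
theorem norm_levelResultant_le {T : ℂ[X]} {n : ℕ} {B : ℝ} (hB : 0 ≤ B)
    (hT : ∀ y : ℝ, ‖T.eval (y * Complex.I)‖ ≤ B * ‖2 + y * Complex.I‖ ^ n) {ζ : ℂ}
    (hζ : ‖ζ‖ = 1) : ‖levelResultant T ζ‖ ≤ B ^ 8 * (1021 - 40 * ζ.re) ^ n := by
  have hre := abs_le.1 ((Complex.abs_re_le_norm ζ).trans hζ.le)
  obtain ⟨y, hy⟩ := exists_real_roots_sq (2 * ζ.re) (by linarith) (by linarith)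
  have key : (fun α => ‖levelFactor ζ α‖) = fun α =>
      ∏ j, (‖(y j : ℂ) * Complex.I - α‖ * ‖((-y j : ℝ) : ℂ) * Complex.I - α‖) := by
    funext α
    rw [norm_levelFactor_of_norm_eq_one hζ, hy, norm_prod]
    refine Finset.prod_congr rfl fun j _ => ?_
    rw [← norm_mul]
    congr 1
    push_cast
    linear_combination (y j : ℂ) ^ 2 * Complex.I_sq
  have e : ‖levelResultant T ζ‖ =
      ∏ j, (‖T.eval (y j * Complex.I)‖ * ‖T.eval ((-y j : ℝ) * Complex.I)‖) := by
    rw [norm_levelResultant_eq, key, Multiset.prod_map_finset_prod]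
    simp only [Multiset.prod_map_mul, norm_eval_eq_prod_roots, Finset.prod_mul_distrib,
      Finset.prod_const, Finset.card_univ, Fintype.card_fin]
    ring
  -- The product of the weights is the level polynomial at `s = 2`, namely `1021 - 20 x` with `x = 2
  -- Re ζ`.
  have h4 : ∏ j, (4 + y j ^ 2) = 1021 - 40 * ζ.re := by
    have := hy 2
    have h : ((1021 - 40 * ζ.re : ℝ) : ℂ) = ((∏ j, (4 + y j ^ 2) : ℝ) : ℂ) := by
      push_cast at this ⊢
      norm_num at this ⊢
      rw [← this]
      ring
    exact (Complex.ofReal_injective h).symm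
  rw [e, ← h4, ← Finset.prod_pow]
  have hc : B ^ 8 = ∏ _j : Fin 4, (B * B) := by simp; ring
  rw [hc, ← Finset.prod_mul_distrib]
  refine Finset.prod_le_prod (fun j _ => by positivity) fun j _ => ?_
  have hn : ‖(2 : ℂ) + y j * Complex.I‖ * ‖(2 : ℂ) + (-y j : ℝ) * Complex.I‖ = 4 + y j ^ 2 := by
    rw [← norm_mul]
    have : ((2 : ℂ) + y j * Complex.I) * (2 + (-y j : ℝ) * Complex.I) =
        ((4 + y j ^ 2 : ℝ) : ℂ) := by
      push_cast
      linear_combination -(y j : ℂ) ^ 2 * Complex.I_sq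
    rw [this, Complex.norm_real, Real.norm_of_nonneg (by positivity)]
  calc _ ≤ (B * ‖(2 : ℂ) + y j * Complex.I‖ ^ n) *
        (B * ‖(2 : ℂ) + (-y j : ℝ) * Complex.I‖ ^ n) :=
        mul_le_mul (hT _) (hT _) (norm_nonneg _) (by positivity)
    _ = B * B * (4 + y j ^ 2) ^ n := by rw [← hn, mul_pow]; ring

theorem differentiable_levelResultant (T : ℂ[X]) : Differentiable ℂ (levelResultant T) := by
  unfold levelResultant
  refine (differentiable_const _).mul ?_
  induction T.roots using Multiset.induction with
  | empty => simp
  | cons a m ih =>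
    simp only [Multiset.map_cons, Multiset.prod_cons]
    refine Differentiable.mul ?_ ih
    unfold levelFactor
    fun_prop

/-- Maximum principle after division by `(1 - cζ)^(2n)`, `c = 20 / 1021`, which equals `1` at `0`.
On the circle `1021 |1 - cζ|² = 1021 + 400 / 1021 - 40 Re ζ` dominates the bound, so only the mean
`1021` survives. -/
theorem norm_levelResultant_zero_le {T : ℂ[X]} {n : ℕ} {B : ℝ}
    (hT : ∀ ζ : ℂ, ‖ζ‖ = 1 → ‖levelResultant T ζ‖ ≤ B ^ 8 * (1021 - 40 * ζ.re) ^ n) :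
    ‖levelResultant T 0‖ ≤ B ^ 8 * 1021 ^ n := by
  have hne : ∀ ζ ∈ Metric.closedBall (0 : ℂ) 1, (1 - 20 / 1021 * ζ) ^ (2 * n) ≠ 0 := by
    intro ζ hζ
    refine pow_ne_zero _ fun h => ?_
    have h1 : ‖(20 / 1021 * ζ : ℂ)‖ = 1 := by
      rw [show (20 / 1021 * ζ : ℂ) = 1 by linear_combination -h]; simp
    rw [norm_mul] at h1
    have : ‖(20 / 1021 : ℂ)‖ = 20 / 1021 := by simp
    have h2 : ‖ζ‖ ≤ 1 := by simpa using hζ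
    rw [this] at h1
    linarith
  have hd : DiffContOnCl ℂ
      (fun ζ => levelResultant T ζ / (1 - 20 / 1021 * ζ) ^ (2 * n)) (Metric.ball 0 1) := by
    refine DifferentiableOn.diffContOnCl ?_
    rw [closure_ball _ one_ne_zero]
    refine (differentiable_levelResultant T).differentiableOn.div ?_ hne
    fun_prop
  have := Complex.norm_le_of_forall_mem_frontier_norm_le (C := B ^ 8 * 1021 ^ n)
    Metric.isBounded_ball hd ?_ (subset_closure (Metric.mem_ball_self one_pos))
  · simpa using this
  · intro ζ hζ
    rw [frontier_ball _ one_ne_zero] at hζ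
    have h1 : ‖ζ‖ = 1 := by simpa using hζ
    have hz := hne ζ (Metric.sphere_subset_closedBall hζ)
    rw [norm_div, div_le_iff₀ (norm_pos_iff.2 hz)]
    refine (hT ζ h1).trans ?_
    rw [mul_assoc, norm_pow, pow_mul, ← mul_pow]
    refine mul_le_mul_of_nonneg_left ?_ (by positivity)
    have hre := abs_le.1 ((Complex.abs_re_le_norm ζ).trans h1.le)
    refine pow_le_pow_left₀ (by linarith) ?_ n
    have hsq : ζ.re * ζ.re + ζ.im * ζ.im = 1 := by
      rw [← Complex.normSq_apply, Complex.normSq_eq_norm_sq, h1]; norm_num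
    rw [← Complex.normSq_eq_norm_sq, Complex.normSq_apply]
    simp only [Complex.sub_re, Complex.one_re, Complex.mul_re, Complex.sub_im, Complex.one_im,
      Complex.mul_im]
    have hr : (20 / 1021 : ℂ).re = 20 / 1021 := by
      rw [show (20 / 1021 : ℂ) = ((20 / 1021 : ℝ) : ℂ) by push_cast; rfl, Complex.ofReal_re]
    have hi : (20 / 1021 : ℂ).im = 0 := by
      rw [show (20 / 1021 : ℂ) = ((20 / 1021 : ℝ) : ℂ) by push_cast; rfl, Complex.ofReal_im]
    rw [hr, hi]
    nlinarith [hsq]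

theorem exists_int_aeval_I (T : ℤ[X]) : ∃ a b : ℤ, aeval Complex.I T = a + b * Complex.I := by
  induction T using Polynomial.induction_on' with
  | add p q hp hq =>
    obtain ⟨a, b, h⟩ := hp
    obtain ⟨c, d, h'⟩ := hq
    exact ⟨a + c, b + d, by rw [map_add, h, h']; push_cast; ring⟩
  | monomial n c =>
    have : ∃ a b : ℤ, Complex.I ^ n = a + b * Complex.I := by
      induction n with
      | zero => exact ⟨1, 0, by simp⟩
      | succ n ih =>
        obtain ⟨a, b, h⟩ := ih
        exact ⟨-b, a, by
          rw [pow_succ, h]; push_cast; linear_combination (b : ℂ) * Complex.I_sq⟩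
    obtain ⟨a, b, h⟩ := this
    exact ⟨c * a, c * b, by rw [aeval_monomial, h]; simp; ring⟩

theorem one_le_norm_aeval_I {T : ℤ[X]} (h : aeval Complex.I T ≠ 0) :
    1 ≤ ‖aeval Complex.I T‖ := by
  obtain ⟨a, b, hab⟩ := exists_int_aeval_I T
  rw [hab] at h ⊢
  rw [← one_le_sq_iff₀ (norm_nonneg _), ← Complex.normSq_eq_norm_sq, Complex.normSq_apply]
  simp only [Complex.add_re, Complex.intCast_re, Complex.mul_re, Complex.I_re, Complex.intCast_im,
    Complex.I_im, Complex.add_im, Complex.mul_im]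
  have : 0 < a * a + b * b := by
    by_contra hc
    have ha : a = 0 := by nlinarith
    have hb : b = 0 := by nlinarith
    exact h (by simp [ha, hb])
  have h1 : (1 : ℤ) ≤ a * a + b * b := this
  have h2 : (1 : ℝ) ≤ a * a + b * b := by exact_mod_cast h1
  linarith

theorem X_sq_add_one_dvd {T : ℤ[X]} (h : aeval Complex.I T = 0) : (X ^ 2 + 1 : ℤ[X]) ∣ T := by
  have hm : (X ^ 2 + 1 : ℤ[X]).Monic := by monicity!
  rw [← modByMonic_eq_zero_iff_dvd hm]
  have h2 : aeval Complex.I (T %ₘ (X ^ 2 + 1)) = 0 := by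
    have := congrArg (aeval Complex.I) (modByMonic_add_div T (X ^ 2 + 1 : ℤ[X]))
    simpa [h] using this
  have hd : (T %ₘ (X ^ 2 + 1)).natDegree < 2 := by
    have := natDegree_modByMonic_lt T hm (by intro h; simpa using congrArg (eval 1) h)
    rwa [show (X ^ 2 + 1 : ℤ[X]).natDegree = 2 by compute_degree!] at this
  generalize T %ₘ (X ^ 2 + 1) = r at h2 hd
  rw [eq_X_add_C_of_natDegree_le_one (Nat.le_of_lt_succ hd)] at h2 ⊢
  have hre := congrArg Complex.re h2
  have him := congrArg Complex.im h2
  simp at hre him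
  simp [hre, him]

/-- Since `M = 1` at `u = 0` and `u = 1`, the factors `X` and `X² + 1` contribute only powers of
`ζ`. These have modulus `1` on the circle, so discarding them keeps the boundary bound and makes the
value at `ζ = 0` nonzero. -/
theorem exists_levelResultant_eq_pow_mul (T : ℤ[X]) (hT : T ≠ 0) :
    ∃ (R : ℤ[X]) (k : ℕ), R.eval 0 ≠ 0 ∧ aeval Complex.I R ≠ 0 ∧
      ∀ ζ, levelResultant (T.map (algebraMap ℤ ℂ)) ζ =
        ζ ^ k * levelResultant (R.map (algebraMap ℤ ℂ)) ζ := by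
  have hinj : Function.Injective (algebraMap ℤ ℂ) := (algebraMap ℤ ℂ).injective_int
  induction hn : T.natDegree using Nat.strong_induction_on generalizing T with
  | _ n ih =>
    have step (Q S : ℤ[X]) (hTQ : T = Q * S) (hQ : 0 < Q.natDegree) (l : ℕ)
        (hQl : ∀ ζ, levelResultant (Q.map (algebraMap ℤ ℂ)) ζ = ζ ^ l) :
        ∃ (R : ℤ[X]) (k : ℕ), R.eval 0 ≠ 0 ∧ aeval Complex.I R ≠ 0 ∧
          ∀ ζ, levelResultant (T.map (algebraMap ℤ ℂ)) ζ =
            ζ ^ k * levelResultant (R.map (algebraMap ℤ ℂ)) ζ := by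
      have hQ0 : Q ≠ 0 := by rintro rfl; simp at hTQ; exact hT hTQ
      have hS0 : S ≠ 0 := by rintro rfl; simp at hTQ; exact hT hTQ
      obtain ⟨R, k, h0, hI, hR⟩ := ih S.natDegree
        (by rw [← hn, hTQ, natDegree_mul hQ0 hS0]; omega) S hS0 rfl
      refine ⟨R, l + k, h0, hI, fun ζ => ?_⟩
      rw [hTQ, Polynomial.map_mul, levelResultant_mul
        ((Polynomial.map_ne_zero_iff hinj).2 hQ0) ((Polynomial.map_ne_zero_iff hinj).2 hS0),
        hQl, hR]
      ring
    by_cases h0 : T.eval 0 = 0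
    · obtain ⟨S, hS⟩ := X_dvd_iff.2 ((coeff_zero_eq_eval_zero T).trans h0)
      exact step X S hS (by simp) 1 fun ζ => by simp [levelResultant_X]
    by_cases hI : aeval Complex.I T = 0
    · obtain ⟨S, hS⟩ := X_sq_add_one_dvd hI
      refine step _ S hS ?_ 2 fun ζ => ?_
      · rw [show (X ^ 2 + 1 : ℤ[X]).natDegree = 2 by compute_degree!]; norm_num
      · rw [← levelResultant_X_sq_add_one]; simp
    · exact ⟨T, 0, h0, hI, by simp⟩

/-- A lower bound, along the imaginary axis, for integer polynomials weighted by `|2 + s|⁻ⁿ`. -/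
theorem one_le_of_norm_aeval_le {T : ℤ[X]} (hT0 : T ≠ 0) {n : ℕ} {B : ℝ} (hB : 0 ≤ B)
    (hT : ∀ y : ℝ, ‖aeval (y * Complex.I) T‖ ≤ B * ‖2 + y * Complex.I‖ ^ n) :
    1 ≤ B ^ 8 * 1021 ^ n := by
  obtain ⟨R, k, h0, hI, hR⟩ := exists_levelResultant_eq_pow_mul T hT0
  have hR0 : R ≠ 0 := by rintro rfl; simp at h0
  have hle : ‖levelResultant (R.map (algebraMap ℤ ℂ)) 0‖ ≤ B ^ 8 * 1021 ^ n := by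
    refine norm_levelResultant_zero_le fun ζ hζ => ?_
    have := norm_levelResultant_le (T := T.map (algebraMap ℤ ℂ)) hB
      (fun y => by rw [eval_map_algebraMap]; exact hT y) hζ
    rwa [hR, norm_mul, norm_pow, hζ, one_pow, one_mul] at this
  refine le_trans ?_ hle
  rw [norm_levelResultant_zero]
  simp only [eval_map_algebraMap]
  have hlc : 1 ≤ ‖(R.map (algebraMap ℤ ℂ)).leadingCoeff‖ := by
    rw [leadingCoeff_map_of_injective (algebraMap ℤ ℂ).injective_int]
    simp only [algebraMap_int_eq, eq_intCast, Complex.norm_intCast]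
    exact_mod_cast Int.one_le_abs (leadingCoeff_ne_zero.2 hR0)
  have h0' : 1 ≤ ‖aeval (0 : ℂ) R‖ := by
    have : aeval (0 : ℂ) R = ((R.eval 0 : ℤ) : ℂ) := by
      simpa using (aeval_algebraMap_apply_eq_algebraMap_eval (A := ℂ) (0 : ℤ) R)
    rw [this, Complex.norm_intCast]
    exact_mod_cast Int.one_le_abs h0
  have hI1 := one_le_norm_aeval_I hI
  have hI2 : 1 ≤ ‖aeval (-Complex.I) R‖ := by
    have : aeval (-Complex.I) R = (starRingEnd ℂ) (aeval Complex.I R) := by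
      rw [← Complex.conj_I]
      obtain ⟨f, hf⟩ : ∃ f : ℂ →ₐ[ℤ] ℂ, ∀ z, f z = (starRingEnd ℂ) z :=
        ⟨(starRingEnd ℂ).toIntAlgHom, fun z => rfl⟩
      rw [← hf, ← hf, aeval_algHom_apply]
    rw [this, Complex.norm_conj]
    exact hI1
  exact one_le_mul_of_one_le_of_one_le (one_le_pow₀ hlc)
    (one_le_mul_of_one_le_of_one_le (one_le_pow₀ h0') (one_le_mul_of_one_le_of_one_le hI1 hI2))

/-! ### Sup norms: attained minima and submultiplicativity. -/

theorem norm_aeval_le_supNormOn {E : Set ℂ} (hE : IsCompact E) (p : ℤ[X]) {z : ℂ} (hz : z ∈ E) :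
    ‖aeval z p‖ ≤ supNormOn E p :=
  le_csSup (hE.bddAbove_image (by fun_prop)) ⟨z, hz, rfl⟩

theorem supNormOn_le {E : Set ℂ} (hE : E.Nonempty) {p : ℤ[X]} {B : ℝ}
    (h : ∀ z ∈ E, ‖aeval z p‖ ≤ B) : supNormOn E p ≤ B :=
  csSup_le (hE.image _) (by rintro _ ⟨z, hz, rfl⟩; exact h z hz)

theorem supNormOn_nonneg (E : Set ℂ) (p : ℤ[X]) : 0 ≤ supNormOn E p :=
  Real.sSup_nonneg (by rintro _ ⟨z, _, rfl⟩; exact norm_nonneg _)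

theorem finite_setOf_natDegree_le_of_abs_coeff_le (n : ℕ) (B : ℝ) :
    {p : ℤ[X] | p.natDegree ≤ n ∧ ∀ i, |(p.coeff i : ℝ)| ≤ B}.Finite := by
  have hfin : (Set.univ.pi fun _ : Fin (n + 1) => Set.Icc (-⌈B⌉) ⌈B⌉).Finite :=
    Set.Finite.pi fun _ => Set.finite_Icc _ _
  refine Set.Finite.of_finite_image (f := fun p (i : Fin (n + 1)) => p.coeff i)
    (hfin.subset ?_) ?_
  · rintro _ ⟨p, ⟨-, hp⟩, rfl⟩ i -
    have := abs_le.1 ((hp i).trans (Int.le_ceil B))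
    exact ⟨by exact_mod_cast this.1, by exact_mod_cast this.2⟩
  · intro p hp q hq h
    ext i
    by_cases hi : i < n + 1
    · exact congrFun h ⟨i, hi⟩
    · rw [coeff_eq_zero_of_natDegree_lt (by have := hp.1; omega),
        coeff_eq_zero_of_natDegree_lt (by have := hq.1; omega)]

/-- Lagrange interpolation at `n + 1` points of `E` recovers the coefficients from values. Hence
only finitely many integer polynomials of degree at most `n` have norm below a given bound. -/
theorem exists_abs_coeff_le {E : Set ℂ} (hE : IsCompact E) (hinf : E.Infinite) (n : ℕ) :
    ∃ K : ℝ, ∀ p : ℤ[X], p.natDegree ≤ n → ∀ i, |(p.coeff i : ℝ)| ≤ supNormOn E p * K := by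
  obtain ⟨s, hs, hcard⟩ := hinf.exists_subset_card_eq (n + 1)
  refine ⟨∑ z ∈ s, ∑ k ∈ Finset.range (n + 1), ‖(Lagrange.basis s id z).coeff k‖,
    fun p hp i => ?_⟩
  have hnn : 0 ≤ ∑ z ∈ s, ∑ k ∈ Finset.range (n + 1), ‖(Lagrange.basis s id z).coeff k‖ :=
    Finset.sum_nonneg fun _ _ => Finset.sum_nonneg fun _ _ => norm_nonneg _
  by_cases hi : i < n + 1
  swap
  · rw [coeff_eq_zero_of_natDegree_lt (by omega)]
    simpa using mul_nonneg (supNormOn_nonneg E p) hnn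
  have hint := Lagrange.eq_interpolate (s := s) (v := id) (f := p.map (algebraMap ℤ ℂ))
    (fun _ _ _ _ h => h) (by
      refine (degree_map_le).trans_lt (degree_le_natDegree.trans_lt ?_)
      rw [hcard]
      exact_mod_cast Nat.lt_succ_of_le hp)
  have hc : algebraMap ℤ ℂ (p.coeff i) = ∑ z ∈ s, aeval z p * (Lagrange.basis s id z).coeff i := by
    have := congrArg (fun q => coeff q i) hint
    simpa only [Lagrange.interpolate_apply, finsetSum_coeff, coeff_C_mul, coeff_map, id,
      eval_map_algebraMap] using this
  have : |(p.coeff i : ℝ)| = ‖algebraMap ℤ ℂ (p.coeff i)‖ := by simp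
  rw [this, hc, Finset.mul_sum]
  refine (norm_sum_le _ _).trans (Finset.sum_le_sum fun z hz => ?_)
  rw [norm_mul]
  exact mul_le_mul (norm_aeval_le_supNormOn hE p (hs hz))
    (Finset.single_le_sum (f := fun k => ‖(Lagrange.basis s id z).coeff k‖)
      (fun _ _ => norm_nonneg _) (Finset.mem_range.2 hi)) (norm_nonneg _) (supNormOn_nonneg E p)

theorem isLeast_minSupNorm {E : Set ℂ} (hE : IsCompact E) (hinf : E.Infinite) (n : ℕ) :
    IsLeast (supNormValues n E) (minSupNorm n E) := by
  set S := {p : ℤ[X] | p ≠ 0 ∧ p.natDegree = n ∧ supNormOn E p ≤ supNormOn E (X ^ n)} with hS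
  have hfin : S.Finite := by
    obtain ⟨K, hK⟩ := exists_abs_coeff_le hE hinf n
    refine (finite_setOf_natDegree_le_of_abs_coeff_le n (supNormOn E (X ^ n) * |K|)).subset ?_
    rintro p ⟨-, hp, hle⟩
    refine ⟨hp.le, fun i => (hK p hp.le i).trans ?_⟩
    exact (mul_le_mul_of_nonneg_left (le_abs_self K) (supNormOn_nonneg E p)).trans
      (mul_le_mul_of_nonneg_right hle (abs_nonneg K))
  have hX : X ^ n ∈ S := ⟨pow_ne_zero _ X_ne_zero, natDegree_X_pow n, le_rfl⟩
  obtain ⟨p, hp, hmin⟩ := Set.exists_min_image S (supNormOn E) hfin ⟨_, hX⟩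
  have hleast : IsLeast (supNormValues n E) (supNormOn E p) := by
    refine ⟨⟨p, hp.1, hp.2.1, rfl⟩, ?_⟩
    rintro _ ⟨q, hq0, hq, rfl⟩
    by_cases hle : supNormOn E q ≤ supNormOn E (X ^ n)
    · exact hmin q ⟨hq0, hq, hle⟩
    · exact hp.2.2.trans (not_le.1 hle).le
  rw [minSupNorm, hleast.csInf_eq]
  exact hleast

theorem minSupNorm_le {E : Set ℂ} {p : ℤ[X]} (hp : p ≠ 0) :
    minSupNorm p.natDegree E ≤ supNormOn E p :=
  csInf_le ⟨0, by rintro _ ⟨q, _, _, rfl⟩; exact supNormOn_nonneg E q⟩ ⟨p, hp, rfl, rfl⟩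

theorem minSupNorm_add_le {E : Set ℂ} (hE : IsCompact E) (hinf : E.Infinite) (a b : ℕ) :
    minSupNorm (a + b) E ≤ minSupNorm a E * minSupNorm b E := by
  obtain ⟨p, hp0, hp, hpe⟩ := (isLeast_minSupNorm hE hinf a).1
  obtain ⟨q, hq0, hq, hqe⟩ := (isLeast_minSupNorm hE hinf b).1
  rw [← hpe, ← hqe, ← hp, ← hq, ← natDegree_mul hp0 hq0]
  refine (minSupNorm_le (mul_ne_zero hp0 hq0)).trans (supNormOn_le hinf.nonempty fun z hz => ?_)
  rw [map_mul, norm_mul]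
  exact mul_le_mul (norm_aeval_le_supNormOn hE p hz) (norm_aeval_le_supNormOn hE q hz)
    (norm_nonneg _) (supNormOn_nonneg E p)

/-! ### Transfer of the lower bound to the quarter disc. -/

theorem isCompact_quarterDisc : IsCompact quarterDisc := isCompact_closedBall _ _

theorem isCompact_halfDisc : IsCompact halfDisc := isCompact_closedBall _ _

theorem infinite_closedBall (c : ℂ) {r : ℝ} (hr : 0 < r) : (Metric.closedBall c r).Infinite :=
  infinite_of_mem_nhds c (Metric.closedBall_mem_nhds c hr)

theorem infinite_quarterDisc : quarterDisc.Infinite := infinite_closedBall _ (by norm_num)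

theorem infinite_halfDisc : halfDisc.Infinite := infinite_closedBall _ (by norm_num)

/-- With `w = 2 + iy` one has `1/w - 1/4 = conj w / (4w)`, of modulus exactly `1/4`. -/
theorem inv_two_add_mem_quarterDisc (y : ℝ) : (2 + y * Complex.I)⁻¹ ∈ quarterDisc := by
  have h0 : (2 + y * Complex.I : ℂ) ≠ 0 := fun h => by simpa using congrArg Complex.re h
  have h : (2 + y * Complex.I : ℂ)⁻¹ - 1 / 4 =
      (1 / 4) * ((starRingEnd ℂ) (2 + y * Complex.I) / (2 + y * Complex.I)) := by
    rw [map_add, map_mul, Complex.conj_I, Complex.conj_ofReal, map_ofNat]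
    field_simp
    ring
  rw [quarterDisc, Metric.mem_closedBall, dist_eq_norm, h, norm_mul,
    norm_div ((starRingEnd ℂ) _), Complex.norm_conj, div_self (norm_ne_zero_iff.2 h0)]
  simp

theorem one_le_supNormOn_quarterDisc {p : ℤ[X]} (hp : p ≠ 0) {n : ℕ} (hn : p.natDegree ≤ n) :
    1 ≤ supNormOn quarterDisc p ^ 8 * 1021 ^ n := by
  -- This `T` is `(2 + s)^n p(1 / (2 + s))`; reflection at `n` rather than at the degree covers
  -- every degree at most `n`.
  refine one_le_of_norm_aeval_le (T := (reflect n p).comp (X + C 2)) ?_ (supNormOn_nonneg _ p)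
    fun y => ?_
  · rwa [Ne, comp_X_add_C_eq_zero_iff, reflect_eq_zero_iff]
  · have h0 : (2 + y * Complex.I : ℂ) ≠ 0 := fun h => by simpa using congrArg Complex.re h
    let _ : Invertible ((2 + y * Complex.I : ℂ)⁻¹) := invertibleOfNonzero (inv_ne_zero h0)
    have h := eval₂_reflect_mul_pow (algebraMap ℤ ℂ) (2 + y * Complex.I : ℂ)⁻¹ n p hn
    rw [invOf_eq_inv, inv_inv, inv_pow, ← div_eq_mul_inv, div_eq_iff (pow_ne_zero _ h0)] at h
    rw [aeval_comp, aeval_def]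
    have he : aeval (y * Complex.I : ℂ) (X + C 2 : ℤ[X]) = 2 + y * Complex.I := by
      simp [add_comm, map_ofNat]
    rw [he, h, norm_mul, norm_pow]
    exact mul_le_mul_of_nonneg_right
      (norm_aeval_le_supNormOn isCompact_quarterDisc p (inv_two_add_mem_quarterDisc y))
      (by positivity)

theorem supNormOn_quarterDisc_pos {p : ℤ[X]} (hp : p ≠ 0) : 0 < supNormOn quarterDisc p := by
  refine lt_of_le_of_ne (supNormOn_nonneg _ _) fun h => ?_
  have := one_le_supNormOn_quarterDisc hp le_rfl
  rw [← h] at this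
  norm_num at this

theorem neg_log_supNormOn_quarterDisc_le {p : ℤ[X]} (hp : p ≠ 0) {n : ℕ} (hn : p.natDegree ≤ n) :
    -Real.log (supNormOn quarterDisc p) ≤ n * (Real.log 1021 / 8) := by
  have hpos := supNormOn_quarterDisc_pos hp
  have := Real.log_nonneg (one_le_supNormOn_quarterDisc hp hn)
  rw [Real.log_mul (by positivity) (by positivity), Real.log_pow, Real.log_pow] at this
  push_cast at this
  linarith

/-! ### Comparison of the two discs through `z (1 - z)`. -/

theorem natDegree_X_mul_one_sub_X : (X * (1 - X) : ℤ[X]).natDegree = 2 := by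
  rw [show (X * (1 - X) : ℤ[X]) = -X ^ 2 + X by ring]
  compute_degree!

/-- By symmetry `f - f(0)` vanishes at `0` and `1`, so `X (1 - X)` divides it over `ℤ`; the quotient
is again symmetric and of smaller degree. -/
theorem exists_eq_comp_of_comp_one_sub_eq (f : ℤ[X]) (hf : f.comp (1 - X) = f) :
    ∃ g : ℤ[X], f = g.comp (X * (1 - X)) := by
  induction hn : f.natDegree using Nat.strong_induction_on generalizing f with
  | _ n ih =>
    have h1 : f.eval 1 = f.eval 0 := by
      conv_lhs => rw [← hf]
      simp
    obtain ⟨k, hk⟩ : X ∣ f - C (f.eval 0) := by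
      rw [← sub_zero X, ← C_0, dvd_iff_isRoot]; simp
    obtain ⟨l, hl⟩ : X - C 1 ∣ k := by
      rw [dvd_iff_isRoot]
      have := congrArg (eval 1) hk
      simpa [h1] using this.symm
    have hfl : f = X * (1 - X) * -l + C (f.eval 0) := by
      rw [hl] at hk
      linear_combination hk - X * l * (C_1 : (C 1 : ℤ[X]) = 1)
    by_cases hl0 : l = 0
    · exact ⟨C (f.eval 0), by rw [C_comp]; simpa [hl0] using hfl⟩
    have hne : (X * (1 - X) : ℤ[X]) ≠ 0 := fun h => by simpa using congrArg (eval 2) h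
    have hsym : (-l).comp (1 - X) = -l := by
      refine mul_left_cancel₀ hne ?_
      have h2 := hf
      rw [hfl] at h2
      simp only [add_comp, mul_comp, X_comp, sub_comp, one_comp, C_comp] at h2
      linear_combination h2
    have hdeg : (-l).natDegree < n := by
      have h2 : (f - C (f.eval 0)).natDegree = (X * (1 - X) * -l).natDegree := by
        congr 1; linear_combination hfl
      rw [natDegree_sub_C, natDegree_mul hne (neg_ne_zero.2 hl0), hn,
        natDegree_X_mul_one_sub_X] at h2
      omega
    obtain ⟨g, hg⟩ := ih _ hdeg (-l) hsym rfl
    refine ⟨X * g + C (f.eval 0), ?_⟩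
    rw [add_comp, mul_comp, X_comp, C_comp, ← hg]
    exact hfl

theorem mem_halfDisc {z : ℂ} : z ∈ halfDisc ↔ ‖z - 1 / 2‖ ≤ 1 / 2 := by
  rw [halfDisc, mem_closedBall_iff_norm]

theorem mem_quarterDisc {z : ℂ} : z ∈ quarterDisc ↔ ‖z - 1 / 4‖ ≤ 1 / 4 := by
  rw [quarterDisc, mem_closedBall_iff_norm]

theorem one_sub_mem_halfDisc {z : ℂ} (hz : z ∈ halfDisc) : 1 - z ∈ halfDisc := by
  rw [mem_halfDisc] at hz ⊢
  rwa [show 1 - z - 1 / 2 = -(z - 1 / 2) by ring, norm_neg]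

theorem mul_one_sub_mem_quarterDisc {z : ℂ} : z * (1 - z) ∈ quarterDisc ↔ z ∈ halfDisc := by
  rw [mem_halfDisc, mem_quarterDisc, show z * (1 - z) - 1 / 4 = -(z - 1 / 2) ^ 2 by ring, norm_neg,
    norm_pow, show (1 / 4 : ℝ) = (1 / 2) ^ 2 by norm_num]
  exact pow_le_pow_iff_left₀ (norm_nonneg _) (by norm_num) two_ne_zero

theorem exists_mul_one_sub_eq (v : ℂ) : ∃ z : ℂ, z * (1 - z) = v := by
  obtain ⟨c, hc⟩ := IsAlgClosed.exists_pow_nat_eq (1 / 4 - v) two_pos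
  exact ⟨1 / 2 + c, by linear_combination -hc⟩

/-- For a minimizer `p` on the half disc, `p(z) p(1 - z)` is `g(z (1 - z))` with `g` integral of
degree `n`, and `z ↦ 1 - z` preserves the half disc. -/
theorem minSupNorm_quarterDisc_le (n : ℕ) :
    minSupNorm n quarterDisc ≤ minSupNorm n halfDisc ^ 2 := by
  obtain ⟨p, hp0, hp, hpe⟩ := (isLeast_minSupNorm isCompact_halfDisc infinite_halfDisc n).1
  have hcomp : (1 - X : ℤ[X]).comp (1 - X) = X := by simp
  obtain ⟨g, hg⟩ := exists_eq_comp_of_comp_one_sub_eq (p * p.comp (1 - X)) (by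
    rw [mul_comp, comp_assoc, hcomp, comp_X, mul_comm])
  have hd1 : (1 - X : ℤ[X]).natDegree = 1 := by
    rw [show (1 - X : ℤ[X]) = -X + 1 by ring]; compute_degree!
  have hpc0 : p.comp (1 - X) ≠ 0 := fun h => hp0 <| by
    have := congrArg (fun q => q.comp (1 - X)) h
    simpa [comp_assoc, hcomp] using this
  have hgd : g.natDegree = n := by
    have := congrArg natDegree hg
    rw [natDegree_mul hp0 hpc0, natDegree_comp, natDegree_comp, hd1, natDegree_X_mul_one_sub_X,
      hp] at this
    omega
  have hg0 : g ≠ 0 := by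
    rintro rfl
    exact mul_ne_zero hp0 hpc0 (by rw [hg, zero_comp])
  have hle : minSupNorm n quarterDisc ≤ supNormOn quarterDisc g := hgd ▸ minSupNorm_le hg0
  rw [← hpe]
  refine hle.trans (supNormOn_le infinite_quarterDisc.nonempty fun v hv => ?_)
  obtain ⟨z, rfl⟩ := exists_mul_one_sub_eq v
  have hz := mul_one_sub_mem_quarterDisc.1 hv
  have h := congrArg (aeval z) hg
  rw [aeval_comp, map_mul, aeval_comp] at h
  simp only [map_mul, map_sub, map_one, aeval_X] at h
  rw [← h, norm_mul, sq]
  exact mul_le_mul (norm_aeval_le_supNormOn isCompact_halfDisc p hz)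
    (norm_aeval_le_supNormOn isCompact_halfDisc p (one_sub_mem_halfDisc hz)) (norm_nonneg _)
    (supNormOn_nonneg _ p)

theorem minSupNorm_halfDisc_two_mul_le (n : ℕ) :
    minSupNorm (2 * n) halfDisc ≤ minSupNorm n quarterDisc := by
  obtain ⟨q, hq0, hq, hqe⟩ := (isLeast_minSupNorm isCompact_quarterDisc infinite_quarterDisc n).1
  have hd : (q.comp (X * (1 - X))).natDegree = 2 * n := by
    rw [natDegree_comp, natDegree_X_mul_one_sub_X, hq, mul_comm]
  have h0 : q.comp (X * (1 - X)) ≠ 0 := by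
    intro h
    rcases comp_eq_zero_iff.1 h with h | ⟨-, h⟩
    · exact hq0 h
    · have := congrArg natDegree h
      rw [natDegree_X_mul_one_sub_X, natDegree_C] at this
      omega
  rw [← hqe, ← hd]
  refine (minSupNorm_le h0).trans (supNormOn_le infinite_halfDisc.nonempty fun z hz => ?_)
  rw [aeval_comp]
  refine norm_aeval_le_supNormOn isCompact_quarterDisc q ?_
  simpa using mul_one_sub_mem_quarterDisc.2 hz

/-! ### Existence of the limits and their relation. -/

theorem exists_tendsto_log_minSupNorm {E : Set ℂ} (hE : IsCompact E) (hinf : E.Infinite) {c : ℝ}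
    (hc : 0 ≤ c) (h : ∀ n : ℕ, Real.exp (-(n * c)) ≤ minSupNorm n E) :
    ∃ L : ℝ, Tendsto (fun n : ℕ => Real.log (minSupNorm n E) / n) atTop (𝓝 L) ∧
      (∀ n : ℕ, n ≠ 0 → L ≤ Real.log (minSupNorm n E) / n) ∧
      IsMinSupNormLimit E (Real.exp L) := by
  have hpos (n : ℕ) : 0 < minSupNorm n E := (Real.exp_pos _).trans_le (h n)
  have hsub : Subadditive fun n => Real.log (minSupNorm n E) := fun a b => by
    rw [← Real.log_mul (hpos a).ne' (hpos b).ne']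
    exact Real.log_le_log (hpos _) (minSupNorm_add_le hE hinf a b)
  have hbdd : BddBelow (Set.range fun n : ℕ => Real.log (minSupNorm n E) / n) := by
    refine ⟨-c, ?_⟩
    rintro _ ⟨n, rfl⟩
    -- At `n = 0` the quotient is `0` by convention, whence the need for `0 ≤ c`.
    rcases n.eq_zero_or_pos with rfl | hn
    · simpa using hc
    · have hn' : (0 : ℝ) < n := by exact_mod_cast hn
      dsimp only
      rw [le_div_iff₀ hn']
      have := (Real.le_log_iff_exp_le (hpos n)).2 (h n)
      linarith
  -- The Fekete limit is at most every term with `n ≠ 0`, so one good polynomial bounds it from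
  -- above.
  refine ⟨hsub.lim, hsub.tendsto_lim hbdd, fun n hn => hsub.lim_le_div hbdd hn, ?_⟩
  refine ((Real.continuous_exp.tendsto _).comp (hsub.tendsto_lim hbdd)).congr fun n => ?_
  rw [Real.rpow_def_of_pos (hpos n), mul_one_div]
  rfl

theorem exp_le_minSupNorm_quarterDisc (n : ℕ) :
    Real.exp (-(n * (Real.log 1021 / 8))) ≤ minSupNorm n quarterDisc := by
  obtain ⟨p, hp0, hp, hpe⟩ := (isLeast_minSupNorm isCompact_quarterDisc infinite_quarterDisc n).1
  rw [← hpe, ← Real.le_log_iff_exp_le (supNormOn_quarterDisc_pos hp0)]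
  linarith [neg_log_supNormOn_quarterDisc_le hp0 hp.le]

theorem exp_le_minSupNorm_halfDisc (n : ℕ) :
    Real.exp (-(n * (Real.log 1021 / 16))) ≤ minSupNorm n halfDisc := by
  refine le_of_sq_le_sq ?_ ?_
  · refine le_trans (le_of_eq ?_)
      ((exp_le_minSupNorm_quarterDisc n).trans (minSupNorm_quarterDisc_le n))
    rw [← Real.exp_nat_mul]
    congr 1
    push_cast
    ring
  · exact Real.sInf_nonneg (by rintro _ ⟨q, _, _, rfl⟩; exact supNormOn_nonneg _ q)

theorem exists_log_limits :
    ∃ L : ℝ, IsMinSupNormLimit halfDisc (Real.exp L) ∧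
      IsMinSupNormLimit quarterDisc (Real.exp (2 * L)) ∧ -(Real.log 1021 / 8) ≤ 2 * L ∧
      ∀ n : ℕ, n ≠ 0 → 2 * L ≤ Real.log (minSupNorm n quarterDisc) / n := by
  have hlog : 0 ≤ Real.log 1021 := Real.log_nonneg (by norm_num)
  obtain ⟨L, hL, -, hlim⟩ := exists_tendsto_log_minSupNorm isCompact_halfDisc infinite_halfDisc
    (by positivity) exp_le_minSupNorm_halfDisc
  obtain ⟨L', hL', hle', hlim'⟩ := exists_tendsto_log_minSupNorm isCompact_quarterDisc
    infinite_quarterDisc (by positivity) exp_le_minSupNorm_quarterDisc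
  have hpos (n : ℕ) := (Real.exp_pos _).trans_le (exp_le_minSupNorm_halfDisc n)
  have hpos' (n : ℕ) := (Real.exp_pos _).trans_le (exp_le_minSupNorm_quarterDisc n)
  have h1 : L' ≤ 2 * L := by
    refine le_of_tendsto_of_tendsto' hL' (hL.const_mul 2) fun n => ?_
    have := Real.log_le_log (hpos' n) (minSupNorm_quarterDisc_le n)
    rw [Real.log_pow] at this
    rw [← mul_div_assoc]
    gcongr
    exact_mod_cast this
  have h2 : 2 * L ≤ L' := by
    -- Composition with `X (1 - X)` yields even degrees only; since the limit exists, that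
    -- subsequence suffices.
    have hsub : Tendsto (fun n : ℕ => 2 * n) atTop atTop :=
      tendsto_id.const_mul_atTop' two_pos
    refine le_of_tendsto_of_tendsto' ((hL.comp hsub).const_mul 2) hL' fun n => ?_
    have := Real.log_le_log (hpos (2 * n)) (minSupNorm_halfDisc_two_mul_le n)
    simp only [Function.comp_apply, Nat.cast_mul, Nat.cast_ofNat]
    rw [mul_div_assoc', mul_div_mul_left _ _ two_ne_zero]
    gcongr
  obtain rfl : L' = 2 * L := le_antisymm h1 h2
  refine ⟨L, hlim, hlim', ?_, hle'⟩
  refine ge_of_tendsto hL' ?_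
  filter_upwards [eventually_gt_atTop 0] with n hn
  have hn' : (0 : ℝ) < n := by exact_mod_cast hn
  rw [le_div_iff₀ hn']
  have := (Real.le_log_iff_exp_le (hpos' n)).2 (exp_le_minSupNorm_quarterDisc n)
  linarith

/-! ### Upper bound from the polynomial of degree 50. -/

/-- Each factor is bounded separately on `[a, b]`. The convex quadratic is at most its endpoint
values and at least its tangent at the midpoint, which is affine and so also checked at the
endpoints (`hla`, `hlb`). -/
theorem degree_fifty_bound_on {a b m k t : ℝ} (ha : 0 ≤ a) (hat : a ≤ t) (htb : t ≤ b)
    (hb : b ≤ 1) (hma : -m ≤ 5 * a - 4) (hmb : 5 * b - 4 ≤ m)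
    (hka : 29 * a ^ 2 - 44 * a + 16 ≤ k) (hkb : 29 * b ^ 2 - 44 * b + 16 ≤ k)
    (hla : -k ≤ 29 * ((a + b) * a - ((a + b) / 2) ^ 2) - 44 * a + 16)
    (hlb : -k ≤ 29 * ((a + b) * b - ((a + b) / 2) ^ 2) - 44 * b + 16)
    (h : b ^ 17 * (1 - a) ^ 3 * m ^ 3 * k ≤ 4 ^ 22 * (219 / 500) ^ 50) :
    t ^ 17 * (1 - t) ^ 3 * |5 * t - 4| ^ 3 * |29 * t ^ 2 - 44 * t + 16| ≤
      4 ^ 22 * (219 / 500) ^ 50 := by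
  have h1 : |5 * t - 4| ≤ m := abs_le.2 ⟨by linarith, by linarith⟩
  have h2 : |29 * t ^ 2 - 44 * t + 16| ≤ k := by
    refine abs_le.2 ⟨?_, ?_⟩
    · have hsq := sq_nonneg (t - (a + b) / 2)
      rcases le_total 0 (29 * (a + b) - 44) with hs | hs
      · nlinarith [mul_nonneg hs (sub_nonneg.2 hat)]
      · nlinarith [mul_nonneg (neg_nonneg.2 hs) (sub_nonneg.2 htb)]
    · rcases le_total 0 (29 * (b + t) - 44) with hs | hs
      · nlinarith [mul_nonneg hs (sub_nonneg.2 htb)]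
      · have hs' : 0 ≤ 44 - 29 * (a + t) := by linarith
        nlinarith [mul_nonneg hs' (sub_nonneg.2 hat)]
  have ht : 0 ≤ t := ha.trans hat
  have ht1 : 0 ≤ 1 - t := by linarith
  have hm : 0 ≤ m := (abs_nonneg _).trans h1
  have hb0 : 0 ≤ b := ht.trans htb
  have ha1 : 0 ≤ 1 - a := by linarith
  refine le_trans ?_ h
  gcongr

theorem degree_fifty_bound {t : ℝ} (h0 : 0 ≤ t) (h1 : t ≤ 1) :
    t ^ 17 * (1 - t) ^ 3 * |5 * t - 4| ^ 3 * |29 * t ^ 2 - 44 * t + 16| ≤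
      4 ^ 22 * (219 / 500) ^ 50 := by
  have hl := h0
  rcases le_total t (351 / 1000) with h | h'
  · exact degree_fifty_bound_on (a := 0) (m := 4) (k := 8447 / 500) (by norm_num) hl h
      (by norm_num) (by norm_num) (by norm_num) (by norm_num) (by norm_num) (by norm_num)
      (by norm_num) (by norm_num)
  replace hl := h'
  rcases le_total t (57 / 125) with h | h'
  · exact degree_fifty_bound_on (a := 351 / 1000) (m := 449 / 200) (k := 4209 / 1000) (by norm_num) hl h
      (by norm_num) (by norm_num) (by norm_num) (by norm_num) (by norm_num) (by norm_num)
      (by norm_num) (by norm_num)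
  replace hl := h'
  rcases le_total t (103 / 200) with h | h'
  · exact degree_fifty_bound_on (a := 57 / 125) (m := 43 / 25) (k := 249 / 125) (by norm_num) hl h
      (by norm_num) (by norm_num) (by norm_num) (by norm_num) (by norm_num) (by norm_num)
      (by norm_num) (by norm_num)
  replace hl := h'
  rcases le_total t (141 / 250) with h | h'
  · exact degree_fifty_bound_on (a := 103 / 200) (m := 57 / 40) (k := 1049 / 1000) (by norm_num) hl h
      (by norm_num) (by norm_num) (by norm_num) (by norm_num) (by norm_num) (by norm_num)
      (by norm_num) (by norm_num)
  replace hl := h'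
  rcases le_total t (313 / 500) with h | h'
  · exact degree_fifty_bound_on (a := 141 / 250) (m := 59 / 50) (k := 437 / 1000) (by norm_num) hl h
      (by norm_num) (by norm_num) (by norm_num) (by norm_num) (by norm_num) (by norm_num)
      (by norm_num) (by norm_num)
  replace hl := h'
  rcases le_total t (673 / 1000) with h | h'
  · exact degree_fifty_bound_on (a := 313 / 500) (m := 87 / 100) (k := 247 / 500) (by norm_num) hl h
      (by norm_num) (by norm_num) (by norm_num) (by norm_num) (by norm_num) (by norm_num)
      (by norm_num) (by norm_num)
  replace hl := h'
  rcases le_total t (717 / 1000) with h | h'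
  · exact degree_fifty_bound_on (a := 673 / 1000) (m := 127 / 200) (k := 327 / 500) (by norm_num) hl h
      (by norm_num) (by norm_num) (by norm_num) (by norm_num) (by norm_num) (by norm_num)
      (by norm_num) (by norm_num)
  replace hl := h'
  rcases le_total t (197 / 250) with h | h'
  · exact degree_fifty_bound_on (a := 717 / 1000) (m := 83 / 200) (k := 727 / 1000) (by norm_num) hl h
      (by norm_num) (by norm_num) (by norm_num) (by norm_num) (by norm_num) (by norm_num)
      (by norm_num) (by norm_num)
  replace hl := h'
  rcases le_total t (173 / 200) with h | h'
  · exact degree_fifty_bound_on (a := 197 / 250) (m := 13 / 40) (k := 177 / 250) (by norm_num) hl h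
      (by norm_num) (by norm_num) (by norm_num) (by norm_num) (by norm_num) (by norm_num)
      (by norm_num) (by norm_num)
  replace hl := h'
  rcases le_total t (901 / 1000) with h | h'
  · exact degree_fifty_bound_on (a := 173 / 200) (m := 101 / 200) (k := 371 / 1000) (by norm_num) hl h
      (by norm_num) (by norm_num) (by norm_num) (by norm_num) (by norm_num) (by norm_num)
      (by norm_num) (by norm_num)
  replace hl := h'
  rcases le_total t (467 / 500) with h | h'
  · exact degree_fifty_bound_on (a := 901 / 1000) (m := 67 / 100) (k := 211 / 1000) (by norm_num) hl h
      (by norm_num) (by norm_num) (by norm_num) (by norm_num) (by norm_num) (by norm_num)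
      (by norm_num) (by norm_num)
  replace hl := h'
  rcases le_total t (951 / 1000) with h | h'
  · exact degree_fifty_bound_on (a := 467 / 500) (m := 151 / 200) (k := 193 / 500) (by norm_num) hl h
      (by norm_num) (by norm_num) (by norm_num) (by norm_num) (by norm_num) (by norm_num)
      (by norm_num) (by norm_num)
  replace hl := h'
  rcases le_total t (193 / 200) with h | h'
  · exact degree_fifty_bound_on (a := 951 / 1000) (m := 33 / 40) (k := 547 / 1000) (by norm_num) hl h
      (by norm_num) (by norm_num) (by norm_num) (by norm_num) (by norm_num) (by norm_num)
      (by norm_num) (by norm_num)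
  replace hl := h'
  rcases le_total t (123 / 125) with h | h'
  · exact degree_fifty_bound_on (a := 193 / 200) (m := 23 / 25) (k := 787 / 1000) (by norm_num) hl h
      (by norm_num) (by norm_num) (by norm_num) (by norm_num) (by norm_num) (by norm_num)
      (by norm_num) (by norm_num)
  replace hl := h'
  exact degree_fifty_bound_on (a := 123 / 125) (m := 1) (k := 501 / 500) (by norm_num) hl h1
    (by norm_num) (by norm_num) (by norm_num) (by norm_num) (by norm_num) (by norm_num)
    (by norm_num) (by norm_num)

/-- With `z = 1 / (2 + s)`, `s = iy`, the last three base factors are, up to sign, powers of `z`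
times `s`, `s² + 1` and `s⁴ + 3s² + 1`. Their moduli depend on `y²` and `|z|`, and `|z|² (4 + y²) =
1` eliminates `y`. The power `4^22` clears `17 + 3 + 2` factors of `4`. -/
theorem norm_degree_fifty_eq {z : ℂ} (hz : ‖z - 1 / 4‖ = 1 / 4) (hz0 : z ≠ 0) :
    ‖z ^ 34 * (2 * z - 1) ^ 6 * (5 * z ^ 2 - 4 * z + 1) ^ 3 *
        (29 * z ^ 4 - 44 * z ^ 3 + 27 * z ^ 2 - 8 * z + 1)‖ * 4 ^ 22 =
      (4 * ‖z‖ ^ 2) ^ 17 * (1 - 4 * ‖z‖ ^ 2) ^ 3 * |5 * (4 * ‖z‖ ^ 2) - 4| ^ 3 *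
        |29 * (4 * ‖z‖ ^ 2) ^ 2 - 44 * (4 * ‖z‖ ^ 2) + 16| := by
  have hcirc : z.re ^ 2 + z.im ^ 2 = z.re / 2 := by
    have h := congrArg (· ^ 2) hz
    simp only [← Complex.normSq_eq_norm_sq, Complex.normSq_apply, Complex.sub_re,
      Complex.sub_im] at h
    norm_num at h
    linarith
  have hn : ‖z‖ ^ 2 = z.re / 2 := by
    rw [← Complex.normSq_eq_norm_sq, Complex.normSq_apply, ← hcirc]; ring
  have hr : 0 < ‖z‖ := norm_pos_iff.2 hz0
  obtain ⟨y, hy⟩ : ∃ y : ℝ, 1 = z * (2 + y * Complex.I) := by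
    refine ⟨(z⁻¹).im, ?_⟩
    have : z⁻¹ = 2 + (z⁻¹).im * Complex.I := by
      apply Complex.ext
      · have hre : z.re ≠ 0 := by
          intro h; rw [h] at hn; norm_num at hn; exact hz0 hn
        simp only [Complex.inv_re, Complex.normSq_eq_norm_sq, hn]
        simp
        field_simp
      · simp
    rw [← this, mul_inv_cancel₀ hz0]
  have hI := Complex.I_sq
  have hu : ‖z‖ ^ 2 * (4 + y ^ 2) = 1 := by
    have h := congrArg Complex.normSq hy
    rw [map_one, map_mul, Complex.normSq_eq_norm_sq, Complex.normSq_apply] at h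
    simp at h
    linarith
  have e1 : 2 * z - 1 = -(z * (y * Complex.I)) := by linear_combination -hy
  have hsq : z ^ 2 * (y : ℂ) ^ 2 = -(1 - 2 * z) ^ 2 := by
    have hv : z * (y * Complex.I) = 1 - 2 * z := by linear_combination -hy
    rw [← hv]
    linear_combination (z ^ 2 * (y : ℂ) ^ 2) * hI
  have e2 : 5 * z ^ 2 - 4 * z + 1 = z ^ 2 * ((1 - y ^ 2 : ℝ) : ℂ) := by
    push_cast
    linear_combination hsq
  have e3 : 29 * z ^ 4 - 44 * z ^ 3 + 27 * z ^ 2 - 8 * z + 1 =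
      z ^ 4 * (((y ^ 2) ^ 2 - 3 * y ^ 2 + 1 : ℝ) : ℂ) := by
    push_cast
    linear_combination ((1 - 2 * z) ^ 2 - z ^ 2 * (y : ℂ) ^ 2 + 3 * z ^ 2) * hsq
  rw [e1, e2, e3]
  simp only [norm_mul, norm_pow, norm_neg, Complex.norm_real, Complex.norm_I, Real.norm_eq_abs,
    mul_one]
  have hy6 : (‖z‖ * |y|) ^ 6 = (1 - 4 * ‖z‖ ^ 2) ^ 3 := by
    rw [show (‖z‖ * |y|) ^ 6 = (‖z‖ ^ 2 * |y| ^ 2) ^ 3 by ring, sq_abs]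
    congr 1
    linarith
  have h5 : ‖z‖ ^ 2 * |1 - y ^ 2| = |5 * (4 * ‖z‖ ^ 2) - 4| / 4 := by
    rw [← abs_of_pos (show (0 : ℝ) < 4 by norm_num), ← abs_div, ← abs_of_pos (pow_pos hr 2),
      ← abs_mul]
    simp only [abs_of_pos (show (0 : ℝ) < 4 by norm_num), abs_of_pos (pow_pos hr 2)]
    congr 1
    linarith
  have h29 : ‖z‖ ^ 4 * |(y ^ 2) ^ 2 - 3 * y ^ 2 + 1| =
      |29 * (4 * ‖z‖ ^ 2) ^ 2 - 44 * (4 * ‖z‖ ^ 2) + 16| / 16 := by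
    rw [← abs_of_pos (show (0 : ℝ) < 16 by norm_num), ← abs_div, ← abs_of_pos (pow_pos hr 4),
      ← abs_mul]
    simp only [abs_of_pos (show (0 : ℝ) < 16 by norm_num)]
    congr 1
    have hv : ‖z‖ ^ 2 * y ^ 2 = 1 - 4 * ‖z‖ ^ 2 := by linarith
    linear_combination (‖z‖ ^ 2 * y ^ 2 + 1 - 4 * ‖z‖ ^ 2 - 3 * ‖z‖ ^ 2) * hv
  rw [hy6, h5, h29]
  ring

theorem supNormOn_degree_fifty_le :
    supNormOn quarterDisc (X ^ 34 * (2 * X - 1) ^ 6 * (5 * X ^ 2 - 4 * X + 1) ^ 3 *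
      (29 * X ^ 4 - 44 * X ^ 3 + 27 * X ^ 2 - 8 * X + 1)) ≤ (219 / 500) ^ 50 := by
  refine supNormOn_le infinite_quarterDisc.nonempty fun z hz => ?_
  have hcl : closure (Metric.ball (1 / 4 : ℂ) (1 / 4)) = quarterDisc :=
    closure_ball _ (by norm_num)
  rw [← hcl] at hz
  refine Complex.norm_le_of_forall_mem_frontier_norm_le Metric.isBounded_ball
    (Differentiable.diffContOnCl (Polynomial.differentiable_aeval _)) ?_ hz
  intro w hw
  rw [frontier_ball _ (by norm_num), mem_sphere_iff_norm] at hw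
  simp only [map_mul, map_pow, map_sub, map_add, map_one, aeval_X, map_ofNat]
  -- The point `0` corresponds to `s = ∞` and is missed by the parametrization.
  rcases eq_or_ne w 0 with rfl | h0
  · rw [zero_pow (by norm_num), zero_mul, zero_mul, zero_mul, norm_zero]
    positivity
  have ht : 4 * ‖w‖ ^ 2 ≤ 1 := by
    have : ‖w‖ ≤ 1 / 2 := by
      calc ‖w‖ = ‖(w - 1 / 4) + 1 / 4‖ := by rw [sub_add_cancel]
        _ ≤ ‖w - 1 / 4‖ + ‖(1 / 4 : ℂ)‖ := norm_add_le _ _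
        _ = 1 / 2 := by rw [hw]; norm_num
    nlinarith [norm_nonneg w]
  have := degree_fifty_bound (t := 4 * ‖w‖ ^ 2) (by positivity) ht
  rw [← norm_degree_fifty_eq hw h0, mul_comm (4 ^ 22 : ℝ)] at this
  exact le_of_mul_le_mul_right this (by positivity)

/-! ### Numerical constants and conclusion. -/

theorem log_1021_div_eight_lt : Real.log 1021 / 8 < -Real.log 0.42 := by
  have h : Real.log 1021 < Real.log ((0.42⁻¹ : ℝ) ^ 8) :=
    Real.log_lt_log (by norm_num) (by norm_num)
  rw [Real.log_pow, Real.log_inv] at h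
  push_cast at h
  linarith

theorem log_1021_div_eight_le : Real.log 1021 / 8 ≤ Real.log (1 + √2) := by
  have h2 : (1.414 : ℝ) ≤ √2 := Real.le_sqrt_of_sq_le (by norm_num)
  have h : Real.log 1021 ≤ Real.log ((2.414 : ℝ) ^ 8) :=
    Real.log_le_log (by norm_num) (by norm_num)
  have h' : Real.log 2.414 ≤ Real.log (1 + √2) := Real.log_le_log (by norm_num) (by linarith)
  rw [Real.log_pow] at h
  push_cast at h
  linarith

theorem log_one_add_sqrt_two_lt : Real.log (1 + √2) < 0.89 := by
  have h2 : √2 ≤ 1.4143 := Real.sqrt_le_iff.2 ⟨by norm_num, by norm_num⟩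
  rw [Real.log_lt_iff_lt_exp (by positivity)]
  -- The hundredth power turns `exp 0.89` into `e^89`, so decimal bounds on `e` suffice.
  refine lt_of_pow_lt_pow_left₀ 100 (Real.exp_pos _).le ?_
  rw [← Real.exp_nat_mul, show ((100 : ℕ) : ℝ) * 0.89 = (89 : ℕ) * 1 by norm_num, Real.exp_nat_mul]
  calc (1 + √2) ^ 100 ≤ (2.4143 : ℝ) ^ 100 := by gcongr; linarith
    _ < 2.7182818283 ^ 89 := by norm_num
    _ ≤ Real.exp 1 ^ 89 := by gcongr; exact Real.exp_one_gt_d9.le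

theorem log_438_lt : Real.log (219 / 500) < -0.82 := by
  rw [Real.log_lt_iff_lt_exp (by norm_num), Real.exp_neg, lt_inv_comm₀ (by norm_num)
    (Real.exp_pos _)]
  refine lt_of_pow_lt_pow_left₀ 50 (by norm_num) ?_
  rw [← Real.exp_nat_mul, show ((50 : ℕ) : ℝ) * 0.82 = (41 : ℕ) * 1 by norm_num, Real.exp_nat_mul]
  calc Real.exp 1 ^ 41 ≤ (2.7182818286 : ℝ) ^ 41 := by gcongr; exact Real.exp_one_lt_d9.le
    _ < _ := by norm_num

theorem natDegree_degree_fifty :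
    (X ^ 34 * (2 * X - 1) ^ 6 * (5 * X ^ 2 - 4 * X + 1) ^ 3 *
      (29 * X ^ 4 - 44 * X ^ 3 + 27 * X ^ 2 - 8 * X + 1) : ℤ[X]).natDegree = 50 := by
  compute_degree!

theorem degree_fifty_ne_zero :
    (X ^ 34 * (2 * X - 1) ^ 6 * (5 * X ^ 2 - 4 * X + 1) ^ 3 *
      (29 * X ^ 4 - 44 * X ^ 3 + 27 * X ^ 2 - 8 * X + 1) : ℤ[X]) ≠ 0 := fun h => by
  simpa only [h, natDegree_zero, OfNat.zero_ne_ofNat] using natDegree_degree_fifty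

theorem log_supNormOn_degree_fifty_le :
    Real.log (supNormOn quarterDisc (X ^ 34 * (2 * X - 1) ^ 6 * (5 * X ^ 2 - 4 * X + 1) ^ 3 *
      (29 * X ^ 4 - 44 * X ^ 3 + 27 * X ^ 2 - 8 * X + 1))) ≤ 50 * Real.log (219 / 500) := by
  have := Real.log_le_log (supNormOn_quarterDisc_pos degree_fifty_ne_zero) supNormOn_degree_fifty_le
  rwa [Real.log_pow] at this

theorem log_minSupNorm_fifty_le :
    Real.log (minSupNorm 50 quarterDisc) / (50 : ℕ) ≤ Real.log (219 / 500) := by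
  have h := minSupNorm_le (E := quarterDisc) degree_fifty_ne_zero
  rw [natDegree_degree_fifty] at h
  have := (Real.log_le_log ((Real.exp_pos _).trans_le (exp_le_minSupNorm_quarterDisc 50)) h).trans
    log_supNormOn_degree_fifty_le
  push_cast
  linarith

theorem IsMinSupNormLimit.eventually_bounds {E : Set ℂ} {M a b : ℝ} (h : IsMinSupNormLimit E M)
    (hpos : ∀ n, 0 < minSupNorm n E) (ha : 0 ≤ a) (haM : a < M) (hMb : M < b) :
    ∀ᶠ n : ℕ in atTop, a ^ n < minSupNorm n E ∧ minSupNorm n E < b ^ n := by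
  filter_upwards [h.eventually (lt_mem_nhds haM), h.eventually (gt_mem_nhds hMb),
    eventually_ne_atTop 0] with n h1 h2 hn
  have e : (minSupNorm n E ^ (1 / (n : ℝ))) ^ n = minSupNorm n E := by
    rw [one_div, Real.rpow_inv_natCast_pow (hpos n).le hn]
  have h0 : 0 ≤ minSupNorm n E ^ (1 / (n : ℝ)) := Real.rpow_nonneg (hpos n).le _
  exact ⟨e ▸ pow_lt_pow_left₀ h1 ha hn, by
    simpa only [e] using pow_lt_pow_left₀ h2 h0 hn⟩

theorem mainTheorem12 :
    -- the minimal sup norms are attained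
    (∀ n : ℕ, IsLeast (supNormValues n halfDisc) (minSupNorm n halfDisc)) ∧
    (∀ n : ℕ, IsLeast (supNormValues n quarterDisc) (minSupNorm n quarterDisc)) ∧
    -- the two limits exist, determine each other, and satisfy the stated bounds
    (∃ M M' : ℝ, IsMinSupNormLimit halfDisc M ∧ IsMinSupNormLimit quarterDisc M' ∧
      M' = M ^ 2 ∧ 0.64 < M ∧ M < 0.67 ∧ 0.42 < M' ∧ M' < 0.44) ∧
    -- the corresponding bounds for all large degrees
    (∀ᶠ n : ℕ in atTop,
      (0.42 : ℝ) ^ n < minSupNorm n quarterDisc ∧ minSupNorm n quarterDisc < (0.44 : ℝ) ^ n) ∧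
    (∀ᶠ n : ℕ in atTop,
      (0.64 : ℝ) ^ n < minSupNorm n halfDisc ∧ minSupNorm n halfDisc < (0.67 : ℝ) ^ n) ∧
    -- lower bound `-(1/n) log ‖p‖ ≤ log (1 + √2) < 0.89` in every degree
    (∀ (n : ℕ) (p : ℤ[X]), p ≠ 0 → p.natDegree ≤ n →
      -Real.log (supNormOn quarterDisc p) ≤ n * Real.log (1 + Real.sqrt 2)) ∧
    Real.log (1 + Real.sqrt 2) < 0.89 ∧
    -- the explicit polynomial of degree 50
    0.82 < -(1 / 50) * Real.log (supNormOn quarterDisc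
      (X ^ 34 * (2 * X - 1) ^ 6 * (5 * X ^ 2 - 4 * X + 1) ^ 3 *
        (29 * X ^ 4 - 44 * X ^ 3 + 27 * X ^ 2 - 8 * X + 1))) := by
  have hpos (n : ℕ) := (Real.exp_pos _).trans_le (exp_le_minSupNorm_halfDisc n)
  have hpos' (n : ℕ) := (Real.exp_pos _).trans_le (exp_le_minSupNorm_quarterDisc n)
  obtain ⟨L, hL, hL', hlow, hup⟩ := exists_log_limits
  have hsq : Real.exp (2 * L) = Real.exp L ^ 2 := by
    rw [← Real.exp_nat_mul]; norm_num
  have h42 : 0.42 < Real.exp (2 * L) := by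
    rw [← Real.log_lt_iff_lt_exp (by norm_num)]
    linarith [log_1021_div_eight_lt]
  have h44 : Real.exp (2 * L) < 0.44 := by
    rw [← Real.lt_log_iff_exp_lt (by norm_num)]
    exact ((hup 50 (by norm_num)).trans log_minSupNorm_fifty_le).trans_lt
      (Real.log_lt_log (by norm_num) (by norm_num))
  have h64 : 0.64 < Real.exp L := by
    refine lt_of_pow_lt_pow_left₀ 2 (Real.exp_pos _).le ?_
    rw [← hsq]
    exact lt_trans (by norm_num) h42
  have h67 : Real.exp L < 0.67 := by
    refine lt_of_pow_lt_pow_left₀ 2 (by norm_num) ?_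
    rw [← hsq]
    exact h44.trans (by norm_num)
  refine ⟨isLeast_minSupNorm isCompact_halfDisc infinite_halfDisc,
    isLeast_minSupNorm isCompact_quarterDisc infinite_quarterDisc,
    ⟨_, _, hL, hL', hsq, h64, h67, h42, h44⟩,
    hL'.eventually_bounds hpos' (by norm_num) h42 h44,
    hL.eventually_bounds hpos (by norm_num) h64 h67,
    fun n p hp hn => (neg_log_supNormOn_quarterDisc_le hp hn).trans
      (mul_le_mul_of_nonneg_left log_1021_div_eight_le n.cast_nonneg),
    log_one_add_sqrt_two_lt, ?_⟩
  linarith [log_supNormOn_degree_fifty_le, log_438_lt]
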